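/- Let $d\ge 0$, $n\ge 1$ be integers and let $\mathcal S\subset\{0,1\}^d$ be a nonempty set of actions such that for every $i\in\{1,\dots,d\}$ there is $v\in\mathcal S$ with $v_i=1$. Consider the semi-bandit game: in each round $t=1,\dots,n$ the forecaster draws $V_t\in\mathcal S$ from a distribution $p_t$ on $\mathcal S$ determined by the past, while simultaneously the adversary selects a loss vector $\ell_t\in[0,+\infty)^d$, possibly at random and depending on the past of the game, such that conditionally on the past and on $\ell_t$ the action $V_t$ has law $p_t$; the forecaster suffers the loss $\ell_t^TV_t$ and observes only the coordinates $\ell_{i,t}$ with $V_{i,t}=1$. Its regret is $$\overline R_n=\mathbb E\sum_{t=1}^n \ell_t^TV_t-\min_{v\in\mathcal S}\mathbb E\sum_{t=1}^n\ell_t^Tv .$$ Assume the $L_\infty$ condition $\|\ell_t\|_\infty\le 1$ for all $t=1,\dots,n$. Let $\eta=\sqrt{2/n}$, $\mathcal D=[0,+\infty)^d$, $F(u)=\frac1\eta\sum_{i=1}^d u_i\log u_i$ on $\mathcal D$ (with $0\log 0=0$), and $D_F(u,v)=F(u)-F(v)-(u-v)^T\nabla F(v)$ for $u\in\mathcal D$,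 $v\in\mathrm{Int}(\mathcal D)$. Suppose that the forecaster uses LINEXP, that is, the following strategy, started from $$w_1=\mathop{\mathrm{argmin}}_{w\in\mathrm{Conv}(\mathcal S)}D_F\big(w,(1,\dots,1)^T\big).$$ In each round $t=1,\dots,n$: (a) choose a distribution $p_t$ on $\mathcal S$ with mean $\mathbb E_{V\sim p_t}V=w_t$ and draw $V_t$ from $p_t$; (b) form the estimate $\tilde\ell_{i,t}=\ell_{i,t}\,V_{i,t}/w_{i,t}$, $i=1,\dots,d$; (c) let $w'_{t+1}\in\mathrm{Int}(\mathcal D)$ satisfy $\nabla F(w'_{t+1})=\nabla F(w_t)-\tilde\ell_t$, and let $w_{t+1}\in\mathop{\mathrm{argmin}}_{w\in\mathrm{Conv}(\mathcal S)\cap\mathrm{Int}(\mathcal D)}D_F(w,w'_{t+1})$. Then $$\overline R_n\le d\sqrt{2n}.$$ -/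

import Mathlib

open MeasureTheory ProbabilityTheory

noncomputable section

namespace CombPred

/-- `ℝ^d` with its standard inner product. -/
abbrev Vec (d : ℕ) := EuclideanSpace ℝ (Fin d)

/-- The Bregman divergence `D_F(u,v) = F(u) - F(v) - (u-v)ᵀ ∇F(v)`. -/
def bregman {d : ℕ} (F : Vec d → ℝ) (u v : Vec d) : ℝ :=
  F u - F v - inner ℝ (u - v) (gradient F v)

/-- `w ∈ argmin_{u ∈ K} D_F(u, x)`. -/
def IsBregmanProj {d : ℕ} (F : Vec d → ℝ) (K : Set (Vec d)) (x w : Vec d) : Prop :=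
  w ∈ K ∧ ∀ u ∈ K, bregman F w x ≤ bregman F u x

/-- The update of CLEB (Combinatorial LEarning with Bregman projections) with Legendre function
`F` on `D`, from `w` to `wNext`, with loss estimate `lossEst`: a gradient step to a point `w'` of
`Int(D)` with `∇F(w') = ∇F(w) - lossEst`, followed by the Bregman projection of `w'` on
`Conv(S) ∩ Int(D)`. -/
def ClebUpdate {d : ℕ} (D : Set (Vec d)) (F : Vec d → ℝ) (S : Finset (Vec d))
    (w lossEst wNext : Vec d) : Prop :=
  ∃ w' ∈ interior D, gradient F w' = gradient F w - lossEst ∧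
    IsBregmanProj F (convexHull ℝ (S : Set (Vec d)) ∩ interior D) w' wNext

/-- The domain `[0,+∞)^d` of LINEXP. -/
def orthant (d : ℕ) : Set (Vec d) := {u | ∀ i, 0 ≤ u i}

/-- The Legendre function of LINEXP: `F(u) = (1/η) ∑ᵢ uᵢ log uᵢ` (with `0 log 0 = 0`). -/
def negEntropy {d : ℕ} (η : ℝ) (u : Vec d) : ℝ :=
  (1 / η) * ∑ i, u i * Real.log (u i)

/-- The importance-weighted estimate `ℓᵢ Vᵢ / wᵢ` of the semi-bandit game; it depends on the loss
vector `ℓ` only through the observed coordinates, those with `Vᵢ = 1`. -/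
def semiBanditEstimate {d : ℕ} (l V w : Vec d) : Vec d :=
  WithLp.toLp 2 fun i => l i * (V i / w i)

/-- `p` gives the weights of a probability distribution on the finite set `S` with mean `w`. -/
structure IsDistWithMean {d : ℕ} (S : Finset (Vec d)) (p : Vec d → ℝ) (w : Vec d) : Prop where
  nonneg : ∀ v ∈ S, 0 ≤ p v
  sum_eq_one : ∑ v ∈ S, p v = 1
  mean_eq : ∑ v ∈ S, p v • v = w

/-- The protocol of an `n`-round prediction game with action set `S`. The rounds are
`t = 1, …, n`, and `𝓕 t` is the information generated up to the end of round `t` (past actions,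
past loss vectors, private randomization). In round `t` the forecaster draws the action `V t ∈ S`
from the distribution `p t`, which is determined by `𝓕 (t-1)`; simultaneously the adversary
selects the nonnegative loss vector `ℓ t`, possibly at random and depending on the past, but
without knowing the draw: given `𝓕 (t-1)` and `ℓ t`, the conditional law of `V t` is `p t`. -/
structure IsGame {Ω : Type*} [mΩ : MeasurableSpace Ω] (μ : Measure Ω) (𝓕 : Filtration ℕ mΩ)
    {d : ℕ} (S : Finset (Vec d)) (n : ℕ) (l V : ℕ → Ω → Vec d) (p : ℕ → Ω → Vec d → ℝ) :
    Prop where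
  loss_measurable : ∀ t ∈ Finset.Icc 1 n, Measurable[𝓕 t] (l t)
  loss_nonneg : ∀ t ∈ Finset.Icc 1 n, ∀ ω i, 0 ≤ l t ω i
  action_measurable : ∀ t ∈ Finset.Icc 1 n, Measurable[𝓕 t] (V t)
  action_mem : ∀ t ∈ Finset.Icc 1 n, ∀ ω, V t ω ∈ S
  dist_measurable : ∀ t ∈ Finset.Icc 1 n, ∀ v ∈ S, Measurable[𝓕 (t - 1)] fun ω => p t ω v
  action_law : ∀ t ∈ Finset.Icc 1 n, ∀ v ∈ S,
    μ[(V t ⁻¹' {v}).indicator (fun _ => (1 : ℝ)) |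
        𝓕 (t - 1) ⊔ MeasurableSpace.comap (l t) inferInstance] =ᵐ[μ] fun ω => p t ω v

/-- The forecaster follows LINEXP with learning rate `η`, i.e. CLEB with `D = [0,+∞)^d` and
`F(u) = (1/η) ∑ᵢ uᵢ log uᵢ`, started at `w₁`, with the semi-bandit estimates: in each round the
sampling distribution `p t` is any distribution on `S` with mean `w t`, and `w (t+1)` is the
CLEB update of `w t`. -/
structure IsLinexp {Ω : Type*} {d : ℕ} (η : ℝ) (S : Finset (Vec d)) (n : ℕ) (w₁ : Vec d)
    (l V : ℕ → Ω → Vec d) (p : ℕ → Ω → Vec d → ℝ) (w : ℕ → Ω → Vec d) : Prop where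
  init : ∀ ω, w 1 ω = w₁
  dist : ∀ t ∈ Finset.Icc 1 n, ∀ ω, IsDistWithMean S (p t ω) (w t ω)
  update : ∀ t ∈ Finset.Icc 1 n, ∀ ω,
    ClebUpdate (orthant d) (negEntropy η) S (w t ω)
      (semiBanditEstimate (l t ω) (V t ω) (w t ω)) (w (t + 1) ω)

/-- The regret `E ∑ₜ ℓₜᵀ Vₜ - min_{v ∈ S} E ∑ₜ ℓₜᵀ v`. -/
def regret {Ω : Type*} [MeasurableSpace Ω] (μ : Measure Ω) {d : ℕ} (S : Finset (Vec d))
    (hS : S.Nonempty) (n : ℕ) (l V : ℕ → Ω → Vec d) : ℝ :=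
  (∫ ω, ∑ t ∈ Finset.Icc 1 n, inner ℝ (l t ω) (V t ω) ∂μ) -
    S.inf' hS fun v => ∫ ω, ∑ t ∈ Finset.Icc 1 n, inner ℝ (l t ω) v ∂μ

end CombPred

end

namespace CombPred

/-! Here `D_F` is `1/η` times `relEntropy`. Fix `u ∈ S`. The gradient step multiplies each `w_i` by
`exp(-η ℓ̃_i)`, so with `e^{-x} ≤ 1 - x + x²/2` the drop of the divergence to `u` is at least `η
ℓ̃ᵀ(w - u)` minus `(η²/2) ∑ w_i ℓ̃_i²`; projecting does not increase the divergence
(`clebUpdate_step`). The drops telescope to at most the divergence from `u` to `w₁`, which is at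
most `d`, because `w₁` is itself a projection of `(1,…,1)`.

Pathwise `ℓ̃ᵀw = ℓᵀV`. In expectation `ℓ̃` is unbiased and `w_i ℓ̃_i² = ℓ_i² V_i / w_i` has the mean
of `ℓ_i²`, at most 1 (`integral_importance_weighted`). Hence `η · regret ≤ d + η² n d / 2`, which
equals `2d` for the chosen `η`. -/

/-- The generalized Kullback-Leibler divergence `∑ᵢ (uᵢ log uᵢ - uᵢ log xᵢ - uᵢ + xᵢ)`. -/
noncomputable def relEntropy {d : ℕ} (u x : Vec d) : ℝ :=
  ∑ i, (u i * Real.log (u i) - u i * Real.log (x i) - u i + x i)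

/-! ### Negative entropy and its Bregman divergence. -/

theorem interior_orthant (d : ℕ) : interior (orthant d) = {u : Vec d | ∀ i, 0 < u i} := by
  have h1 : orthant d = (EuclideanSpace.equiv (Fin d) ℝ).toHomeomorph ⁻¹'
      (Set.pi Set.univ fun _ => Set.Ici (0 : ℝ)) := by
    ext u
    simp [orthant]
    rfl
  rw [h1, ← Homeomorph.preimage_interior, interior_pi_set Set.finite_univ]
  ext u
  simp

theorem hasGradientAt_negEntropy {d : ℕ} (η : ℝ) {x : Vec d} (hx : ∀ i, 0 < x i) :
    HasGradientAt (negEntropy η) (WithLp.toLp 2 fun i => 1 / η * (Real.log (x i) + 1)) x := by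
  rw [hasGradientAt_iff_hasFDerivAt]
  have hc : ∀ i, HasFDerivAt (fun u : Vec d => u i * Real.log (u i))
      ((Real.log (x i) + 1) • (EuclideanSpace.proj i : Vec d →L[ℝ] ℝ)) x := fun i =>
    (Real.hasDerivAt_mul_log (hx i).ne').comp_hasFDerivAt (f := fun u : Vec d => u i) x
      (EuclideanSpace.proj i : Vec d →L[ℝ] ℝ).hasFDerivAt
  refine ((HasFDerivAt.fun_sum (u := Finset.univ) fun i _ => hc i).const_mul (1 / η)).congr_fderiv ?_
  ext v
  simp [PiLp.inner_apply, Finset.mul_sum]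
  refine Finset.sum_congr rfl fun i _ => by ring

theorem bregman_negEntropy {d : ℕ} (η : ℝ) (u : Vec d) {x : Vec d} (hx : ∀ i, 0 < x i) :
    bregman (negEntropy η) u x = 1 / η * relEntropy u x := by
  rw [bregman, (hasGradientAt_negEntropy η hx).gradient]
  simp only [negEntropy, relEntropy, PiLp.inner_apply, Finset.mul_sum, ← Finset.sum_sub_distrib]
  refine Finset.sum_congr rfl fun i _ => ?_
  simp
  ring

/-- Termwise: use `log y ≤ y - 1` at `y = x_i / u_i`; when `u_i = 0` the term is `x_i`. -/
theorem relEntropy_nonneg {d : ℕ} {u x : Vec d} (hu : ∀ i, 0 ≤ u i) (hx : ∀ i, 0 < x i) :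
    0 ≤ relEntropy u x := by
  refine Finset.sum_nonneg fun i _ => ?_
  rcases (hu i).eq_or_lt with h | h
  · simp [← h, (hx i).le]
  · have h1 := Real.log_le_sub_one_of_pos (div_pos (hx i) h)
    rw [Real.log_div (hx i).ne' h.ne'] at h1
    have h2 := mul_le_mul_of_nonneg_left h1 h.le
    have h3 : u i * (x i / u i - 1) = x i - u i := by field_simp
    linarith

/-! ### Bregman projections. -/

/-- First-order optimality of a minimizer of `relEntropy · x` along a segment. -/
theorem relEntropy_first_order {d : ℕ} {u x w : Vec d} (hw : ∀ i, 0 < w i)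
    (hmin : ∀ s : ℝ, 0 < s → s < 1 → relEntropy w x ≤ relEntropy (w + s • (u - w)) x) :
    0 ≤ ∑ i, (Real.log (w i) - Real.log (x i)) * (u i - w i) := by
  have hd : HasDerivAt (fun s : ℝ => relEntropy (w + s • (u - w)) x)
      (∑ i, (Real.log (w i) - Real.log (x i)) * (u i - w i)) 0 := by
    refine HasDerivAt.fun_sum fun i _ => ?_
    have h0 : HasDerivAt (fun s : ℝ => (w + s • (u - w)) i) (u i - w i) 0 := by
      simpa using ((hasDerivAt_id (0 : ℝ)).mul_const (u i - w i)).const_add (w i)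
    have h1 : HasDerivAt (fun s : ℝ => (w + s • (u - w)) i * Real.log ((w + s • (u - w)) i))
        ((Real.log (w i) + 1) * (u i - w i)) 0 :=
      HasDerivAt.comp (h₂ := fun y => y * Real.log y) 0
        (by simpa using Real.hasDerivAt_mul_log (hw i).ne') h0
    refine (((h1.sub (h0.mul_const (Real.log (x i)))).sub h0).add_const (x i)).congr_deriv ?_
    ring
  refine ge_of_tendsto hd.tendsto_slope_zero_right ?_
  filter_upwards [Ioo_mem_nhdsGT (zero_lt_one' ℝ)] with s hs
  have := hmin s hs.1 hs.2
  simp only [zero_add, zero_smul, add_zero, smul_eq_mul]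
  exact mul_nonneg (inv_nonneg.2 hs.1.le) (sub_nonneg.2 this)

/-- Generalized Pythagorean inequality, with the nonnegative term dropped. -/
theorem relEntropy_le_of_first_order {d : ℕ} {u x w : Vec d} (hw : ∀ i, 0 < w i)
    (hx : ∀ i, 0 < x i)
    (h : 0 ≤ ∑ i, (Real.log (w i) - Real.log (x i)) * (u i - w i)) :
    relEntropy u w ≤ relEntropy u x := by
  -- Three-point identity of the divergence.
  have h1 : relEntropy u x = relEntropy u w + relEntropy w x +
      ∑ i, (Real.log (w i) - Real.log (x i)) * (u i - w i) := by
    simp only [relEntropy, ← Finset.sum_add_distrib]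
    exact Finset.sum_congr rfl fun i _ => by ring
  linarith [relEntropy_nonneg (fun i => (hw i).le) hx]

theorem nonneg_of_mem_convexHull {d : ℕ} {S : Set (Vec d)} (hS : ∀ v ∈ S, ∀ i, 0 ≤ v i)
    {u : Vec d} (hu : u ∈ convexHull ℝ S) (i : Fin d) : 0 ≤ u i := by
  have hc : Convex ℝ {u : Vec d | 0 ≤ u i} :=
    convex_halfSpace_ge (EuclideanSpace.proj i : Vec d →L[ℝ] ℝ).toLinearMap.isLinear 0
  exact convexHull_min (fun v hv => hS v hv i) hc hu

/-- A Bregman projection for the negative entropy with positive coordinates is closer to every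
point of the convex set than the projected point. -/
theorem relEntropy_le_of_isBregmanProj {d : ℕ} {η : ℝ} (hη : 0 < η) {C K : Set (Vec d)}
    (hC : Convex ℝ C) (hK : C ∩ interior (orthant d) ⊆ K) {x w u : Vec d}
    (hx : ∀ i, 0 < x i) (hw : ∀ i, 0 < w i) (hwC : w ∈ C)
    (hproj : IsBregmanProj (negEntropy η) K x w) (huC : u ∈ C) (hu : ∀ i, 0 ≤ u i) :
    relEntropy u w ≤ relEntropy u x := by
  refine relEntropy_le_of_first_order hw hx (relEntropy_first_order hw fun s hs0 hs1 => ?_)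
  -- `u` may have zero coordinates; `s < 1` keeps the segment in the open orthant, so `K` may be the
  -- hull or only its part in the interior.
  have hmem : w + s • (u - w) ∈ K := by
    refine hK ⟨hC.add_smul_sub_mem hwC huC ⟨hs0.le, hs1.le⟩, ?_⟩
    rw [interior_orthant]
    intro i
    have h1 : (w + s • (u - w)) i = (1 - s) * w i + s * u i := by simp; ring
    rw [h1]
    have := mul_pos (sub_pos.2 hs1) (hw i)
    have := mul_nonneg hs0.le (hu i)
    linarith
  have := hproj.2 _ hmem
  rw [bregman_negEntropy η _ hx, bregman_negEntropy η _ hx] at this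
  exact le_of_mul_le_mul_left this (by positivity)

/-- The projection of `(1, …, 1)` on a convex set of nonnegative vectors has positive coordinates
where some element of the set does. -/
theorem pos_of_isBregmanProj_one {d : ℕ} {η : ℝ} (hη : 0 < η) {C : Set (Vec d)}
    (hC : Convex ℝ C) (hC0 : ∀ u ∈ C, ∀ i, 0 ≤ u i) {w : Vec d}
    (hproj : IsBregmanProj (negEntropy η) C (WithLp.toLp 2 fun _ => 1) w) {u : Vec d}
    (hu : u ∈ C) (j : Fin d) (huj : u j = 1) : 0 < w j := by
  refine (hC0 w hproj.1 j).lt_of_ne fun hj => ?_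
  let g : ℝ → ℝ := fun y => y * Real.log y - y + 1
  have hone : ∀ i, 0 < (WithLp.toLp 2 (fun _ => (1 : ℝ)) : Vec d) i := fun i => by simp
  have hg : ∀ y : Vec d, relEntropy y (WithLp.toLp 2 fun _ => 1) = ∑ i, g (y i) := fun y =>
    Finset.sum_congr rfl fun i _ => by simp [g]
  set c : ℝ := ∑ i ∈ Finset.univ.erase j, (g (u i) - g (w i)) with hc
  -- Moving from `w` a fraction `s` towards `u` changes the other coordinates' cost by at most `s *
  -- c` (convexity), while coordinate `j` goes from `0` to `s` at cost `s log s - s`. The slope of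
  -- `y log y` is `-∞` at `0`, so small `s` contradicts minimality.
  have key : ∀ s : ℝ, 0 < s → s < 1 → 0 ≤ c + Real.log s - 1 := by
    intro s hs0 hs1
    have h1 := hproj.2 _ (hC.add_smul_sub_mem hproj.1 hu ⟨hs0.le, hs1.le⟩)
    rw [bregman_negEntropy η _ hone, bregman_negEntropy η _ hone] at h1
    have h2 := le_of_mul_le_mul_left h1 (by positivity)
    rw [hg, hg, ← Finset.add_sum_erase _ _ (Finset.mem_univ j),
      ← Finset.add_sum_erase _ _ (Finset.mem_univ j)] at h2
    have h3 : ∑ i ∈ Finset.univ.erase j, g ((w + s • (u - w)) i) ≤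
        ∑ i ∈ Finset.univ.erase j, (g (w i) + s * (g (u i) - g (w i))) := by
      refine Finset.sum_le_sum fun i _ => ?_
      have h4 := Real.convexOn_mul_log.2 (hC0 w hproj.1 i) (hC0 u hu i) (sub_nonneg.2 hs1.le)
        hs0.le (sub_add_cancel 1 s)
      have h5 : (w + s • (u - w)) i = (1 - s) • w i + s • u i := by simp; ring
      rw [h5]
      simp only [g, smul_eq_mul] at h4 ⊢
      linarith
    rw [Finset.sum_add_distrib (f := fun i => g (w i)), ← Finset.mul_sum, ← hc] at h3
    have h6 : (w + s • (u - w)) j = s := by simp [huj, ← hj]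
    rw [h6, ← hj] at h2
    simp only [g] at h2 h3
    have h7 : 0 ≤ s * (c + Real.log s - 1) := by
      simp only [zero_mul] at h2
      linarith
    exact nonneg_of_mul_nonneg_right h7 hs0
  -- This `s` has `log s = -|c| - log 2`; the factor `1/2` ensures `s < 1` even if `c = 0`.
  have h1 := key (Real.exp (-|c|)  / 2) (by positivity) (by
    have : Real.exp (-|c|) ≤ 1 := Real.exp_le_one_iff.2 (by simp)
    linarith)
  rw [Real.log_div (Real.exp_pos _).ne' two_ne_zero, Real.log_exp] at h1
  linarith [le_abs_self c, Real.log_pos one_lt_two]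

/-! ### One round of the update. -/

/-- Combine `e^x ≥ 1 + x + x²/2` with `(1 - x + x²/2)(1 + x + x²/2) = 1 + x⁴/4 ≥ 1`. -/
theorem exp_neg_le_quadratic {x : ℝ} (hx : 0 ≤ x) : Real.exp (-x) ≤ 1 - x + x ^ 2 / 2 := by
  have h1 := mul_le_mul_of_nonneg_left (Real.quadratic_le_exp_of_nonneg hx) (Real.exp_pos (-x)).le
  rw [← Real.exp_add, neg_add_cancel, Real.exp_zero] at h1
  refine le_of_mul_le_mul_right (h1.trans ?_) (by positivity : 0 < 1 + x + x ^ 2 / 2)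
  nlinarith [sq_nonneg (x ^ 2)]

/-- One round of LINEXP: the instantaneous estimated regret is bounded by the decrease of the
divergence to the comparator and a quadratic term. -/
theorem clebUpdate_step {d : ℕ} {η : ℝ} (hη : 0 < η) {S : Finset (Vec d)}
    {w g wNext u : Vec d} (hw : ∀ i, 0 < w i) (hg : ∀ i, 0 ≤ g i)
    (hup : ClebUpdate (orthant d) (negEntropy η) S w g wNext)
    (huS : u ∈ convexHull ℝ (S : Set (Vec d))) (hu : ∀ i, 0 ≤ u i) :
    η * ∑ i, g i * (w i - u i) ≤
      relEntropy u w - relEntropy u wNext + η ^ 2 / 2 * ∑ i, w i * g i ^ 2 := by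
  obtain ⟨w', hw', hgrad, hproj⟩ := hup
  have hn := hproj.1.2
  rw [interior_orthant] at hw' hn
  have h1 := relEntropy_le_of_isBregmanProj hη (convex_convexHull ℝ (S : Set (Vec d))) subset_rfl
    hw' hn hproj.1.1 hproj huS hu
  have hlog : ∀ i, Real.log (w' i) = Real.log (w i) - η * g i := by
    intro i
    rw [(hasGradientAt_negEntropy η hw').gradient, (hasGradientAt_negEntropy η hw).gradient] at hgrad
    have h2 := congrArg (fun v : Vec d => v i) hgrad
    simp only [PiLp.sub_apply] at h2
    field_simp at h2
    linarith
  have hexp : ∀ i, w' i = w i * Real.exp (-(η * g i)) := by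
    intro i
    rw [← Real.exp_log (hw' i), hlog, sub_eq_add_neg, Real.exp_add, Real.exp_log (hw i)]
  -- By `hlog` the difference of divergences is exactly `∑ (w_i - w'_i - η g_i u_i)`.
  have h2 : η * ∑ i, g i * (w i - u i) ≤
      relEntropy u w - relEntropy u w' + η ^ 2 / 2 * ∑ i, w i * g i ^ 2 := by
    simp only [relEntropy, Finset.mul_sum, ← Finset.sum_sub_distrib, ← Finset.sum_add_distrib]
    refine Finset.sum_le_sum fun i _ => ?_
    have h3 := mul_le_mul_of_nonneg_left
      (exp_neg_le_quadratic (mul_nonneg hη.le (hg i))) (hw i).le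
    rw [← hexp] at h3
    rw [hlog]
    linarith
  linarith

/-! ### Conditional expectation and importance weighting. -/

/-- Integrating an `m`-measurable function over an event whose conditional probability given `m`
is `q` amounts to weighting it with `q`. -/
theorem setLIntegral_eq_of_condExp_indicator {Ω : Type*} {m m0 : MeasurableSpace Ω}
    {μ : Measure[m0] Ω} [IsFiniteMeasure μ] (hm : m ≤ m0) {s : Set Ω} (hs : MeasurableSet[m0] s)
    {q : Ω → ℝ} (hq : Measurable[m] q) (hq0 : ∀ ω, 0 ≤ q ω)
    (h : μ[s.indicator (fun _ => (1 : ℝ)) | m] =ᵐ[μ] q)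
    {f : Ω → ENNReal} (hf : Measurable[m] f) :
    ∫⁻ ω in s, f ω ∂μ = ∫⁻ ω, ENNReal.ofReal (q ω) * f ω ∂μ := by
  have hqm : Measurable[m0] fun ω => ENNReal.ofReal (q ω) := (hq.mono hm le_rfl).ennreal_ofReal
  have hqi : Integrable q μ := integrable_condExp.congr h
  -- The defining property of conditional expectation, read as an equality of measures on `m`; it
  -- then applies to every `m`-measurable `f`, integrable or not.
  have hmeas : (μ.restrict s).trim hm = (μ.withDensity fun ω => ENNReal.ofReal (q ω)).trim hm := by
    refine @Measure.ext _ m _ _ fun A hA => ?_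
    have hint : ∫ ω in A, q ω ∂μ = μ.real (A ∩ s) := by
      rw [← setIntegral_congr_ae (hm A hA) (h.mono fun ω hω _ => hω),
        setIntegral_condExp hm ((integrable_const (1 : ℝ)).indicator hs) hA,
        setIntegral_indicator hs]
      simp
    rw [trim_measurableSet_eq hm hA, trim_measurableSet_eq hm hA,
      withDensity_apply _ (hm A hA), Measure.restrict_apply (hm A hA),
      ← ofReal_integral_eq_lintegral_ofReal hqi.integrableOn (Filter.Eventually.of_forall hq0),
      hint, ofReal_measureReal]
  rw [← lintegral_trim hm hf, hmeas, lintegral_trim hm hf,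
    lintegral_withDensity_eq_lintegral_mul _ hqm (hf.mono hm le_rfl)]
  rfl

/-- The coordinates of the drawn action may be replaced by those of the mean of the sampling
distribution, in integrals against functions known before the draw. -/
theorem lintegral_mul_action_coord {Ω : Type*} {m m0 : MeasurableSpace Ω}
    {μ : Measure[m0] Ω} [IsFiniteMeasure μ] (hm : m ≤ m0) {d : ℕ} {S : Finset (Vec d)}
    (hS0 : ∀ v ∈ S, ∀ i, 0 ≤ v i) {V w : Ω → Vec d} {q : Ω → Vec d → ℝ}
    (hV : Measurable[m0] V) (hVS : ∀ ω, V ω ∈ S) (hq : ∀ v ∈ S, Measurable[m] fun ω => q ω v)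
    (hlaw : ∀ v ∈ S, μ[(V ⁻¹' {v}).indicator (fun _ => (1 : ℝ)) | m] =ᵐ[μ] fun ω => q ω v)
    (hdist : ∀ ω, IsDistWithMean S (q ω) (w ω)) {f : Ω → ENNReal} (hf : Measurable[m] f)
    (i : Fin d) :
    ∫⁻ ω, f ω * ENNReal.ofReal (V ω i) ∂μ = ∫⁻ ω, f ω * ENNReal.ofReal (w ω i) ∂μ := by
  classical
  have hs : ∀ v, MeasurableSet[m0] (V ⁻¹' {v}) := fun v => hV (measurableSet_singleton v)
  have hfm := hf.mono hm le_rfl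
  have h1 : ∀ ω, f ω * ENNReal.ofReal (V ω i) =
      ∑ v ∈ S, (V ⁻¹' {v}).indicator (fun ω => f ω * ENNReal.ofReal (v i)) ω := by
    intro ω
    rw [Finset.sum_eq_single_of_mem (V ω) (hVS ω)]
    · simp
    · intro v _ hv
      exact Set.indicator_of_notMem (s := V ⁻¹' {v}) (fun h => hv (Eq.symm h)) _
  have h2 : ∀ ω, f ω * ENNReal.ofReal (w ω i) =
      ∑ v ∈ S, ENNReal.ofReal (q ω v) * (f ω * ENNReal.ofReal (v i)) := by
    intro ω
    rw [← (hdist ω).mean_eq]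
    simp only [WithLp.ofLp_sum, Finset.sum_apply, PiLp.smul_apply, smul_eq_mul]
    rw [ENNReal.ofReal_sum_of_nonneg fun v hv => mul_nonneg ((hdist ω).nonneg v hv) (hS0 v hv i),
      Finset.mul_sum]
    refine Finset.sum_congr rfl fun v hv => ?_
    rw [ENNReal.ofReal_mul ((hdist ω).nonneg v hv)]
    ring
  simp_rw [h1, h2]
  rw [lintegral_finsetSum S fun v _ => (hfm.mul_const _).indicator (hs v),
    lintegral_finsetSum (f := fun v ω => ENNReal.ofReal (q ω v) * (f ω * ENNReal.ofReal (v i)))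
      S fun v hv => ((hq v hv).mono hm le_rfl).ennreal_ofReal.mul (hfm.mul_const _)]
  refine Finset.sum_congr rfl fun v hv => ?_
  rw [lintegral_indicator (hs v)]
  exact setLIntegral_eq_of_condExp_indicator hm (hs v) (hq v hv)
    (fun ω => (hdist ω).nonneg v hv) (hlaw v hv) (hf.mul_const _)

/-- The importance-weighted estimate is integrable and unbiased. -/
theorem integral_importance_weighted {Ω : Type*} {m m0 : MeasurableSpace Ω}
    {μ : Measure[m0] Ω} [IsFiniteMeasure μ] (hm : m ≤ m0) {d : ℕ} {S : Finset (Vec d)}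
    (hS0 : ∀ v ∈ S, ∀ i, 0 ≤ v i) {V w : Ω → Vec d} {q : Ω → Vec d → ℝ}
    (hV : Measurable[m0] V) (hVS : ∀ ω, V ω ∈ S) (hq : ∀ v ∈ S, Measurable[m] fun ω => q ω v)
    (hlaw : ∀ v ∈ S, μ[(V ⁻¹' {v}).indicator (fun _ => (1 : ℝ)) | m] =ᵐ[μ] fun ω => q ω v)
    (hdist : ∀ ω, IsDistWithMean S (q ω) (w ω)) (hw : ∀ ω i, 0 < w ω i)
    {g : Ω → ℝ} (hg : Measurable[m] g) (hg0 : ∀ ω, 0 ≤ g ω) (hgi : Integrable g μ) (i : Fin d) :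
    Integrable (fun ω => g ω * (V ω i / w ω i)) μ ∧
      ∫ ω, g ω * (V ω i / w ω i) ∂μ = ∫ ω, g ω ∂μ := by
  -- `w` is known before the draw because it is the mean of `q`.
  have hwm : Measurable[m] fun ω => w ω i := by
    have h1 : (fun ω => w ω i) = fun ω => ∑ v ∈ S, q ω v * v i := by
      funext ω
      rw [← (hdist ω).mean_eq]
      simp
    rw [h1]
    exact Finset.measurable_sum S fun v hv => (hq v hv).mul_const _
  have hVm : Measurable[m0] fun ω => V ω i :=
    (EuclideanSpace.proj i : Vec d →L[ℝ] ℝ).measurable.comp hV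
  have hV0 : ∀ ω, 0 ≤ V ω i := fun ω => hS0 _ (hVS ω) i
  -- `1 / w` need not be bounded, so integrability is itself deduced from this identity of lower
  -- integrals.
  have hlin : ∫⁻ ω, ENNReal.ofReal (g ω * (V ω i / w ω i)) ∂μ = ∫⁻ ω, ENNReal.ofReal (g ω) ∂μ := by
    have h1 := lintegral_mul_action_coord hm hS0 hV hVS hq hlaw hdist
      (f := fun ω => ENNReal.ofReal (g ω / w ω i)) (hg.div hwm).ennreal_ofReal i
    calc _ = ∫⁻ ω, ENNReal.ofReal (g ω / w ω i) * ENNReal.ofReal (V ω i) ∂μ := by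
          refine lintegral_congr fun ω => ?_
          rw [← ENNReal.ofReal_mul (div_nonneg (hg0 ω) (hw ω i).le)]
          congr 1
          ring
      _ = _ := by
          rw [h1]
          refine lintegral_congr fun ω => ?_
          rw [← ENNReal.ofReal_mul (div_nonneg (hg0 ω) (hw ω i).le)]
          congr 1
          exact div_mul_cancel₀ _ (hw ω i).ne'
  have hnn : ∀ ω, 0 ≤ g ω * (V ω i / w ω i) := fun ω =>
    mul_nonneg (hg0 ω) (div_nonneg (hV0 ω) (hw ω i).le)
  have hmeas : AEStronglyMeasurable (fun ω => g ω * (V ω i / w ω i)) μ :=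
    ((hg.mono hm le_rfl).mul (hVm.div (hwm.mono hm le_rfl))).aestronglyMeasurable
  refine ⟨⟨hmeas, ?_⟩, ?_⟩
  · rw [hasFiniteIntegral_iff_ofReal (Filter.Eventually.of_forall hnn), hlin,
      ← ofReal_integral_eq_lintegral_ofReal hgi (Filter.Eventually.of_forall hg0)]
    exact ENNReal.ofReal_lt_top
  · rw [integral_eq_lintegral_of_nonneg_ae (Filter.Eventually.of_forall hnn) hmeas, hlin,
      ← integral_eq_lintegral_of_nonneg_ae (Filter.Eventually.of_forall hg0) hgi.1]

/-! ### Summing over rounds and taking expectations. -/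

/-- Updates project onto the interior, so only `w₁` needs a hypothesis. The range reaches `n + 1`
because the telescoped sum ends at `w (n + 1)`. -/
theorem IsLinexp.pos {Ω : Type*} {d n : ℕ} {η : ℝ} {S : Finset (Vec d)} {w₁ : Vec d}
    {l V w : ℕ → Ω → Vec d} {p : ℕ → Ω → Vec d → ℝ} (h : IsLinexp η S n w₁ l V p w)
    (hw₁ : ∀ i, 0 < w₁ i) {t : ℕ} (ht : t ∈ Finset.Icc 1 (n + 1)) (ω : Ω) (i : Fin d) :
    0 < w t ω i := by
  obtain ⟨ht1, htn⟩ := Finset.mem_Icc.1 ht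
  rcases ht1.eq_or_lt with rfl | h1
  · rw [h.init]
    exact hw₁ i
  · obtain ⟨s, rfl⟩ : ∃ s, t = s + 1 := ⟨t - 1, by omega⟩
    obtain ⟨w', -, -, hproj⟩ := h.update s (Finset.mem_Icc.2 ⟨by omega, by omega⟩) ω
    have := hproj.1.2
    rw [interior_orthant] at this
    exact this i

/-- The pathwise bound on the estimated regret of LINEXP. -/
theorem IsLinexp.estimated_regret_le {Ω : Type*} {d n : ℕ} {η : ℝ} (hη : 0 < η)
    {S : Finset (Vec d)} (hS01 : ∀ v ∈ S, ∀ i, v i = 0 ∨ v i = 1) {w₁ : Vec d}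
    {l V w : ℕ → Ω → Vec d} {p : ℕ → Ω → Vec d → ℝ} (h : IsLinexp η S n w₁ l V p w)
    (hl : ∀ t ∈ Finset.Icc 1 n, ∀ ω i, 0 ≤ l t ω i) (hV : ∀ t ∈ Finset.Icc 1 n, ∀ ω, V t ω ∈ S)
    (hw₁ : ∀ i, 0 < w₁ i) {u : Vec d} (hu : u ∈ S) (ω : Ω) :
    η * (∑ t ∈ Finset.Icc 1 n, inner ℝ (l t ω) (V t ω) -
        ∑ t ∈ Finset.Icc 1 n, ∑ i, l t ω i * (V t ω i / w t ω i) * u i) ≤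
      relEntropy u w₁ +
        η ^ 2 / 2 * ∑ t ∈ Finset.Icc 1 n, ∑ i, l t ω i ^ 2 * (V t ω i / w t ω i) := by
  have hS0 : ∀ v ∈ S, ∀ i, 0 ≤ v i := fun v hv i => by
    rcases hS01 v hv i with h | h <;> simp [h]
  have hpos : ∀ t ∈ Finset.Icc 1 n, ∀ i, 0 < w t ω i := fun t ht i =>
    h.pos hw₁ (Finset.mem_Icc.2 ⟨(Finset.mem_Icc.1 ht).1, by have := (Finset.mem_Icc.1 ht).2; omega⟩)
      ω i
  have hstep : ∀ t ∈ Finset.Icc 1 n,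
      η * (inner ℝ (l t ω) (V t ω) - ∑ i, l t ω i * (V t ω i / w t ω i) * u i) ≤
        (relEntropy u (w t ω) - relEntropy u (w (t + 1) ω)) +
          η ^ 2 / 2 * ∑ i, l t ω i ^ 2 * (V t ω i / w t ω i) := by
    intro t ht
    have hwt := hpos t ht
    have h1 := clebUpdate_step hη hwt
      (fun i => mul_nonneg (hl t ht ω i) (div_nonneg (hS0 _ (hV t ht ω) i) (hwt i).le))
      (h.update t ht ω) (subset_convexHull ℝ _ hu) (hS0 u hu)
    convert h1 using 2
    · rw [PiLp.inner_apply, ← Finset.sum_sub_distrib]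
      refine Finset.sum_congr rfl fun i _ => ?_
      have := (hwt i).ne'
      simp only [semiBanditEstimate, RCLike.inner_apply, conj_trivial]
      field_simp
    · congr 1
      refine Finset.sum_congr rfl fun i _ => ?_
      have := (hwt i).ne'
      simp only [semiBanditEstimate]
      -- `V_i² = V_i`, so only one factor `1 / w_i` survives.
      rcases hS01 _ (hV t ht ω) i with h | h
      · simp [h]
      · rw [h]
        field_simp
  have htel : ∑ t ∈ Finset.Icc 1 n, (relEntropy u (w t ω) - relEntropy u (w (t + 1) ω)) =
      relEntropy u w₁ - relEntropy u (w (n + 1) ω) := by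
    have h1 := Finset.sum_Ico_sub (fun t => -relEntropy u (w t ω)) (Nat.le_add_left 1 n)
    rw [← h.init ω, ← Finset.Ico_add_one_right_eq_Icc]
    convert h1 using 1
    · exact Finset.sum_congr rfl fun t _ => by ring
    · ring
  have h1 := Finset.sum_le_sum hstep
  rw [← Finset.mul_sum, Finset.sum_sub_distrib, Finset.sum_add_distrib, ← Finset.mul_sum, htel]
    at h1
  have h2 := relEntropy_nonneg (hS0 u hu)
    (fun i => h.pos hw₁ (Finset.mem_Icc.2 ⟨Nat.le_add_left 1 n, le_rfl⟩) ω i)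
  linarith

/-- A coordinate contributes `1` if `u_i = 0` and `0` if `u_i = 1`. -/
theorem relEntropy_one_le {d : ℕ} {u : Vec d} (hu : ∀ i, u i = 0 ∨ u i = 1) :
    relEntropy u (WithLp.toLp 2 fun _ => 1) ≤ d := by
  calc relEntropy u (WithLp.toLp 2 fun _ => 1) ≤ ∑ _i : Fin d, (1 : ℝ) := by
        refine Finset.sum_le_sum fun i _ => ?_
        rcases hu i with h | h <;> simp [h]
    _ = d := by simp

/-- Regret of LINEXP against a fixed action, for a general learning rate. -/
theorem IsLinexp.expected_regret_le {Ω : Type*} [mΩ : MeasurableSpace Ω] {μ : Measure Ω}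
    [IsProbabilityMeasure μ] {𝓕 : Filtration ℕ mΩ} {d n : ℕ} {η : ℝ} (hη : 0 < η)
    {S : Finset (Vec d)} (hS01 : ∀ v ∈ S, ∀ i, v i = 0 ∨ v i = 1) {w₁ : Vec d}
    {l V w : ℕ → Ω → Vec d} {p : ℕ → Ω → Vec d → ℝ} (hgame : IsGame μ 𝓕 S n l V p)
    (hLinf : ∀ t ∈ Finset.Icc 1 n, ∀ ω i, |l t ω i| ≤ 1)
    (h : IsLinexp η S n w₁ l V p w) (hw₁ : ∀ i, 0 < w₁ i) {u : Vec d} (hu : u ∈ S) :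
    η * (∫ ω, ∑ t ∈ Finset.Icc 1 n, inner ℝ (l t ω) (V t ω) ∂μ -
        ∫ ω, ∑ t ∈ Finset.Icc 1 n, inner ℝ (l t ω) u ∂μ) ≤
      relEntropy u w₁ + η ^ 2 / 2 * (n * d) := by
  have hS0 : ∀ v ∈ S, ∀ i, 0 ≤ v i := fun v hv i => by
    rcases hS01 v hv i with h | h <;> simp [h]
  have hlm : ∀ t ∈ Finset.Icc 1 n, ∀ i, Measurable fun ω => l t ω i := fun t ht i =>
    (EuclideanSpace.proj i : Vec d →L[ℝ] ℝ).measurable.comp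
      ((hgame.loss_measurable t ht).mono (𝓕.le t) le_rfl)
  have hVm : ∀ t ∈ Finset.Icc 1 n, Measurable (V t) := fun t ht =>
    (hgame.action_measurable t ht).mono (𝓕.le t) le_rfl
  have hl0 := hgame.loss_nonneg
  have hl1 : ∀ t ∈ Finset.Icc 1 n, ∀ ω i, l t ω i ≤ 1 := fun t ht ω i =>
    (le_abs_self _).trans (hLinf t ht ω i)
  have hli : ∀ t ∈ Finset.Icc 1 n, ∀ i, Integrable (fun ω => l t ω i) μ := fun t ht i =>
    Integrable.of_bound (hlm t ht i).aestronglyMeasurable 1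
      (Filter.Eventually.of_forall fun ω => hLinf t ht ω i)
  have hl2i : ∀ t ∈ Finset.Icc 1 n, ∀ i, Integrable (fun ω => l t ω i ^ 2) μ := fun t ht i =>
    Integrable.of_bound ((hlm t ht i).pow_const 2).aestronglyMeasurable 1
      (Filter.Eventually.of_forall fun ω => by
        rw [Real.norm_eq_abs, abs_pow]
        exact pow_le_one₀ (abs_nonneg _) (hLinf t ht ω i))
  -- The conditioning σ-algebra contains `ℓ_t`, so any function of the current loss counts as known
  -- before the draw; `g` will be a coordinate and its square.
  have hest : ∀ t ∈ Finset.Icc 1 n, ∀ i, ∀ g : Vec d → ℝ, Measurable g → (∀ ω, 0 ≤ g (l t ω)) →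
      Integrable (fun ω => g (l t ω)) μ →
      Integrable (fun ω => g (l t ω) * (V t ω i / w t ω i)) μ ∧
        ∫ ω, g (l t ω) * (V t ω i / w t ω i) ∂μ = ∫ ω, g (l t ω) ∂μ := by
    intro t ht i g hg hg0 hgi
    have hcomap : MeasurableSpace.comap (l t) inferInstance ≤ mΩ :=
      ((hgame.loss_measurable t ht).mono (𝓕.le t) le_rfl).comap_le
    refine integral_importance_weighted
      (m := 𝓕 (t - 1) ⊔ MeasurableSpace.comap (l t) inferInstance) (sup_le (𝓕.le _) hcomap) hS0
      (hVm t ht) (hgame.action_mem t ht)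
      (fun v hv => (hgame.dist_measurable t ht v hv).mono le_sup_left le_rfl)
      (hgame.action_law t ht) (h.dist t ht)
      (fun ω i => h.pos hw₁ (Finset.mem_Icc.2 ⟨(Finset.mem_Icc.1 ht).1,
        (Finset.mem_Icc.1 ht).2.trans (Nat.le_succ n)⟩) ω i) ?_ hg0 hgi i
    exact (hg.comp (comap_measurable (l t))).mono le_sup_right le_rfl
  have hcoord : ∀ i, Measurable fun v : Vec d => v i := fun i =>
    (EuclideanSpace.proj i : Vec d →L[ℝ] ℝ).measurable
  have hX := fun t ht i => hest t ht i (fun v => v i) (hcoord i) (fun ω => hl0 t ht ω i) (hli t ht i)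
  have hY := fun t ht i => hest t ht i (fun v => v i ^ 2) ((hcoord i).pow_const 2)
    (fun ω => sq_nonneg _) (hl2i t ht i)
  have hZi : Integrable (fun ω => ∑ t ∈ Finset.Icc 1 n, inner ℝ (l t ω) (V t ω)) μ := by
    refine integrable_finsetSum _ fun t ht => ?_
    simp only [PiLp.inner_apply, RCLike.inner_apply, conj_trivial]
    refine integrable_finsetSum _ fun i _ => (hli t ht i).bdd_mul (c := 1)
      ((hcoord i).comp (hVm t ht)).aestronglyMeasurable (Filter.Eventually.of_forall fun ω => ?_)
    rcases hS01 _ (hgame.action_mem t ht ω) i with h | h <;> simp [h]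
  have hXi : Integrable (fun ω => ∑ t ∈ Finset.Icc 1 n,
      ∑ i, l t ω i * (V t ω i / w t ω i) * u i) μ :=
    integrable_finsetSum _ fun t ht => integrable_finsetSum _ fun i _ => (hX t ht i).1.mul_const _
  have hYi : Integrable (fun ω => ∑ t ∈ Finset.Icc 1 n,
      ∑ i, l t ω i ^ 2 * (V t ω i / w t ω i)) μ :=
    integrable_finsetSum _ fun t ht => integrable_finsetSum _ fun i _ => (hY t ht i).1
  have hXint : ∫ ω, ∑ t ∈ Finset.Icc 1 n, ∑ i, l t ω i * (V t ω i / w t ω i) * u i ∂μ =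
      ∫ ω, ∑ t ∈ Finset.Icc 1 n, inner ℝ (l t ω) u ∂μ := by
    simp only [PiLp.inner_apply, RCLike.inner_apply, conj_trivial]
    rw [integral_finsetSum _ fun t ht =>
        integrable_finsetSum _ fun i _ => (hX t ht i).1.mul_const (u i),
      integral_finsetSum _ fun t ht =>
        integrable_finsetSum _ fun i _ => (hli t ht i).const_mul (u i)]
    refine Finset.sum_congr rfl fun t ht => ?_
    rw [integral_finsetSum _ fun i _ => (hX t ht i).1.mul_const (u i),
      integral_finsetSum _ fun i _ => (hli t ht i).const_mul (u i)]
    refine Finset.sum_congr rfl fun i _ => ?_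
    rw [integral_mul_const, integral_const_mul, (hX t ht i).2, mul_comm]
  have hYint : ∫ ω, ∑ t ∈ Finset.Icc 1 n, ∑ i, l t ω i ^ 2 * (V t ω i / w t ω i) ∂μ ≤ n * d := by
    rw [integral_finsetSum _ fun t ht => integrable_finsetSum _ fun i _ => (hY t ht i).1]
    calc _ ≤ ∑ _t ∈ Finset.Icc 1 n, ∑ _i : Fin d, (1 : ℝ) := by
          refine Finset.sum_le_sum fun t ht => ?_
          rw [integral_finsetSum _ fun i _ => (hY t ht i).1]
          refine Finset.sum_le_sum fun i _ => ?_
          rw [(hY t ht i).2]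
          calc _ ≤ ∫ _, (1 : ℝ) ∂μ := integral_mono (hl2i t ht i) (integrable_const 1) fun ω =>
                pow_le_one₀ (hl0 t ht ω i) (hl1 t ht ω i)
            _ = 1 := by simp
      _ = n * d := by simp
  have hmono := integral_mono ((hZi.sub hXi).const_mul η)
    ((integrable_const (relEntropy u w₁)).add (hYi.const_mul (η ^ 2 / 2)))
    fun ω => h.estimated_regret_le hη hS01 hl0 hgame.action_mem hw₁ hu ω
  rw [integral_const_mul, integral_sub' hZi hXi, hXint,
    integral_add' (integrable_const _) (hYi.const_mul _), integral_const_mul] at hmono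
  simp only [integral_const, probReal_univ, one_smul] at hmono
  have := mul_le_mul_of_nonneg_left hYint (by positivity : 0 ≤ η ^ 2 / 2)
  linarith

end CombPred

theorem mainTheorem5 {Ω : Type*} [mΩ : MeasurableSpace Ω] (μ : Measure Ω) [IsProbabilityMeasure μ]
    (𝓕 : Filtration ℕ mΩ) (d n : ℕ) (hn : 1 ≤ n)
    (S : Finset (CombPred.Vec d)) (hS : S.Nonempty)
    (hS01 : ∀ v ∈ S, ∀ i, v i = 0 ∨ v i = 1)
    (hScov : ∀ i, ∃ v ∈ S, v i = 1)
    (l V w : ℕ → Ω → CombPred.Vec d) (p : ℕ → Ω → CombPred.Vec d → ℝ)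
    (hgame : CombPred.IsGame μ 𝓕 S n l V p)
    (hLinf : ∀ t ∈ Finset.Icc 1 n, ∀ ω i, |l t ω i| ≤ 1)
    (η : ℝ) (hη : η = √(2 / (n : ℝ)))
    (w₁ : CombPred.Vec d)
    (hw₁ : CombPred.IsBregmanProj (CombPred.negEntropy η)
      (convexHull ℝ (S : Set (CombPred.Vec d))) (WithLp.toLp 2 fun _ => 1) w₁)
    (hlinexp : CombPred.IsLinexp η S n w₁ l V p w) :
    CombPred.regret μ S hS n l V ≤ d * √(2 * n) := by
  have hn0 : (0 : ℝ) < n := by exact_mod_cast hn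
  have hη0 : 0 < η := hη ▸ Real.sqrt_pos.2 (by positivity)
  have hS0 : ∀ v ∈ S, ∀ i, 0 ≤ v i := fun v hv i => by
    rcases hS01 v hv i with h | h <;> simp [h]
  have hC := convex_convexHull ℝ (S : Set (CombPred.Vec d))
  have hC0 : ∀ u ∈ convexHull ℝ (S : Set (CombPred.Vec d)), ∀ i, 0 ≤ u i := fun u hu i =>
    CombPred.nonneg_of_mem_convexHull hS0 hu i
  have hpos : ∀ i, 0 < w₁ i := fun i => by
    obtain ⟨v, hv, hvi⟩ := hScov i
    exact CombPred.pos_of_isBregmanProj_one hη0 hC hC0 hw₁ (subset_convexHull ℝ _ hv) i hvi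
  obtain ⟨u, hu, hinf⟩ := Finset.exists_mem_eq_inf' hS
    fun v => ∫ ω, ∑ t ∈ Finset.Icc 1 n, inner ℝ (l t ω) v ∂μ
  rw [CombPred.regret, hinf]
  have h1 := hlinexp.expected_regret_le hη0 hS01 hgame hLinf hpos hu
  have h2 : CombPred.relEntropy u w₁ ≤ d :=
    (CombPred.relEntropy_le_of_isBregmanProj hη0 hC Set.inter_subset_left
      (fun i => by simp) hpos hw₁.1 hw₁ (subset_convexHull ℝ _ hu) (hS0 u hu)).trans
      (CombPred.relEntropy_one_le (hS01 u hu))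
  have h3 : η ^ 2 = 2 / n := by rw [hη, Real.sq_sqrt (by positivity)]
  have h4 : η * √(2 * n) = 2 := by
    rw [hη, ← Real.sqrt_mul (by positivity), show 2 / (n : ℝ) * (2 * n) = 2 ^ 2 by field_simp,
      Real.sqrt_sq two_pos.le]
  -- After multiplication by `η`, the target is `2d`, and both terms of the bound are at most `d`.
  refine le_of_mul_le_mul_left (h1.trans ?_) hη0
  rw [h3, mul_left_comm η, h4]
  have h5 : (2 / n : ℝ) / 2 * (n * d) = d := by field_simp
  linarith
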